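/- **Notation.** Let $A$ be a set, $\widetilde A=A\cup A^{-1}$ with its involution $x\mapsto x^{-1}$, extended to $\widetilde A^*$ by $(x_1\cdots x_n)^{-1}=x_n^{-1}\cdots x_1^{-1}$. Let $\rho_A$ be the congruence on $\widetilde A^*$ generated by all pairs $(ww^{-1}w,w)$ and $(uu^{-1}vv^{-1},vv^{-1}uu^{-1})$. For $R\subseteq\widetilde A^*\times\widetilde A^*$ let $\tau=(\rho_A\cup R)^\sharp$ be the congruence generated by $\rho_A\cup R$; the inverse monoid $\mathrm{Inv}\langle A\mid R\rangle$ is $\widetilde A^*/\tau$. The *Schützenberger automaton* $\mathcal A(w)$ of $w\in\widetilde A^*$ with respect to $\mathrm{Inv}\langle A\mid R\rangle$ has as states the elements of the $\mathcal R$-class of $w\tau$, a transition $m\xrightarrow{x}n$ whenever $m,n$ are in this class, $x\in\widetilde A$ and $n=m\cdot x\tau$, initial state $(ww^{-1})\tau$ and terminal state $w\tau$. For an automaton $\mathcal B$, $\mathrm{Fold}(\mathcal B)$ is obtained by successively identifying states $q,q'$ whenever there are transitions $q\xleftarrow{x}p\xrightarrow{x}q'$ (that is, it is the quotient of $\mathcal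 B$ by the least equivalence relation $\sim$ such that $p\sim p'$, $p\xrightarrow{x}q$, $p'\xrightarrow{x}q'$ imply $q\sim q'$). For a relation $S\subseteq\widetilde A^*\times\widetilde A^*$, an *elementary expansion* of an $\widetilde A$-automaton $\mathcal B$ adds a new path $q_1\xrightarrow{u}q_2$ (together with the inverse path) to $\mathcal B$, where $q_1\xrightarrow{v}q_2$ is a path in $\mathcal B$ and $(u,v)\in S$ or $(v,u)\in S$; when $u$ is empty this identifies $q_1$ and $q_2$. The *(Stephen) closure* $\mathrm{Cl}_S(\mathcal B)$ is the colimit of the directed system of all automata obtained from $\mathcal B$ by finite sequences of elementary expansions and foldings of two edges. For $a\in A$ put $A_a=A\setminus\{a\}$, let $\theta_a:\widetilde A^*\to\widetilde{A_a}^*$ be the homomorphism that erases $a$ and $a^{-1}$ and fixes all other letters, and let $R\overline\theta_a=\{(u\theta_a,v\theta_a):(u,v)\in R\}$. The *$a$-contracted automaton* $\chi_a(\mathcal A)$ of an inverse $\widetilde A$-automaton $\mathcal A$ is $\mathrm{Fold}(\mathcal B)$, where $\mathcal B$ is the $\widetilde{A_a}$-automaton obtained from $\mathcal A$ by identifying all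 states $p,q$ such that $p\xrightarrow{a}q$ is a transition and erasing the resulting loops labelled $a$ and $a^{-1}$. **Proposition.** Let $\mathrm{Inv}\langle A\mid R\rangle$ be a presentation and $a\in A$. For every word $w\in\widetilde A^*$, let $\mathcal A(w)$ be the Schützenberger automaton of $w$ with respect to $\mathrm{Inv}\langle A\mid R\rangle$, and let $\mathcal A(w\theta_a)$ be the Schützenberger automaton of $w\theta_a$ with respect to $\mathrm{Inv}\langle A_a\mid R\overline\theta_a\rangle$. Then $$\mathcal A(w\theta_a)\;\cong\;\mathrm{Cl}_{R\overline\theta_a}\bigl(\chi_a(\mathcal A(w))\bigr),$$ where $\cong$ is isomorphism of automata (a bijection between the states that matches initial states, terminal states and transitions). -/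

import Mathlib

universe u v v'

namespace InvPres

/-! ## Words over `A ∪ A⁻¹` and presentations of inverse monoids -/

/-- The alphabet `A ∪ A⁻¹`: the pair `(a, true)` is the letter `a`, the pair `(a, false)` is the
formal inverse `a⁻¹`. -/
abbrev Letter (A : Type u) : Type u := A × Bool

/-- The involution `a ↔ a⁻¹` of `A ∪ A⁻¹`. -/
def Letter.inv {A : Type u} (x : Letter A) : Letter A := (x.1, !x.2)

/-- The free monoid on `A ∪ A⁻¹`. -/
abbrev Word (A : Type u) : Type u := FreeMonoid (Letter A)

/-- The involution of the free monoid on `A ∪ A⁻¹`: `(x₁ ⋯ xₙ)⁻¹ = xₙ⁻¹ ⋯ x₁⁻¹`. -/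
def Word.inv {A : Type u} (w : Word A) : Word A :=
  FreeMonoid.ofList (w.toList.map Letter.inv).reverse

/-- The pairs `(w w⁻¹ w, w)` and `(u u⁻¹ v v⁻¹, v v⁻¹ u u⁻¹)` generating the Vagner congruence. -/
inductive VagnerRel (A : Type u) : Word A → Word A → Prop
  | regular (w : Word A) : VagnerRel A (w * w.inv * w) w
  | commute (u v : Word A) :
      VagnerRel A (u * u.inv * (v * v.inv)) (v * v.inv * (u * u.inv))

/-- The Vagner congruence `ρ_A`, so that the quotient is the free inverse monoid on `A`. -/
def vagnerCon (A : Type u) : Con (Word A) := conGen (VagnerRel A)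

/-- The congruence `τ` generated by `ρ_A ∪ R`. -/
def presCon {A : Type u} (R : Set (Word A × Word A)) : Con (Word A) :=
  conGen (fun x y => vagnerCon A x y ∨ (x, y) ∈ R)

/-- The inverse monoid presented by `Inv⟨A | R⟩`. -/
abbrev PresMonoid {A : Type u} (R : Set (Word A × Word A)) : Type u := (presCon R).Quotient

/-- The class of a word in the monoid presented by `Inv⟨A | R⟩`. -/
def cls {A : Type u} (R : Set (Word A × Word A)) (w : Word A) : PresMonoid R :=
  (w : (presCon R).Quotient)

/-- Green's relation `𝓡`. -/
def GreenR {M : Type u} [Monoid M] (m n : M) : Prop :=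
  (∃ x, m = n * x) ∧ ∃ y, n = m * y

/-! ## Automata -/

/-- An automaton over the alphabet `X` with one initial and one terminal state; `edge p x q` means
that there is a transition from `p` to `q` labelled `x`. -/
structure Automaton (X : Type u) : Type (max u (v + 1)) where
  State : Type v
  init : State
  term : State
  edge : State → X → State → Prop

namespace Automaton

variable {X : Type u}

/-- `B.Path p w q`: the word `w` labels a path from `p` to `q`. -/
def Path (B : Automaton.{u, v} X) : B.State → List X → B.State → Prop
  | p, [], q => p = q
  | p, x :: w, q => ∃ r, B.edge p x r ∧ Path B r w q

/-- A morphism of automata. -/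
structure Hom (B : Automaton.{u, v} X) (C : Automaton.{u, v'} X) where
  toFun : B.State → C.State
  map_init : toFun B.init = C.init
  map_term : toFun B.term = C.term
  map_edge : ∀ p x q, B.edge p x q → C.edge (toFun p) x (toFun q)

/-- Composition of morphisms (first `f`, then `g`). -/
def Hom.comp {B C D : Automaton.{u, v} X} (f : Hom B C) (g : Hom C D) : Hom B D where
  toFun s := g.toFun (f.toFun s)
  map_init := by rw [f.map_init, g.map_init]
  map_term := by rw [f.map_term, g.map_term]
  map_edge p x q h := g.map_edge _ _ _ (f.map_edge _ _ _ h)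

/-- An isomorphism of automata: a bijection of the states that matches initial states, terminal
states and transitions. -/
structure Iso (B : Automaton.{u, v} X) (C : Automaton.{u, v'} X) where
  toEquiv : B.State ≃ C.State
  map_init : toEquiv B.init = C.init
  map_term : toEquiv B.term = C.term
  map_edge : ∀ p x q, B.edge p x q ↔ C.edge (toEquiv p) x (toEquiv q)

/-- An isomorphism as a morphism. -/
def Iso.toHom {B : Automaton.{u, v} X} {C : Automaton.{u, v'} X} (e : Iso B C) : Hom B C where
  toFun := e.toEquiv
  map_init := e.map_init
  map_term := e.map_term
  map_edge p x q := (e.map_edge p x q).1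

/-- The automaton obtained by identifying states along (the equivalence relation generated by) `r`;
its transitions are the images of those of `B`. -/
def quot (B : Automaton.{u, v} X) (r : B.State → B.State → Prop) : Automaton.{u, v} X where
  State := Quot r
  init := Quot.mk r B.init
  term := Quot.mk r B.term
  edge P x Q := ∃ p q, Quot.mk r p = P ∧ Quot.mk r q = Q ∧ B.edge p x q

/-- The projection onto a quotient automaton. -/
def toQuot (B : Automaton.{u, v} X) (r : B.State → B.State → Prop) : Hom B (B.quot r) where
  toFun := Quot.mk r
  map_init := rfl
  map_term := rfl
  map_edge p _ q h := ⟨p, q, rfl, rfl, h⟩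

/-! ### Folding -/

/-- The states that get identified when one successively identifies the ends `q`, `q'` of any two
transitions with the same label and the same origin: the least equivalence relation `~` such that
`p ~ p'`, `p → q`, `p' → q'` (same label) imply `q ~ q'`. -/
inductive FoldRel (B : Automaton.{u, v} X) : B.State → B.State → Prop
  | refl (p) : FoldRel B p p
  | symm {p q} : FoldRel B p q → FoldRel B q p
  | trans {p q r} : FoldRel B p q → FoldRel B q r → FoldRel B p r
  | fold {p p' q q'} (x : X) :
      FoldRel B p p' → B.edge p x q → B.edge p' x q' → FoldRel B q q'

/-- `Fold(B)`. -/
def fold (B : Automaton.{u, v} X) : Automaton.{u, v} X := B.quot B.FoldRel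

/-- The relation used to identify the two states `q` and `q'`. -/
def Single (B : Automaton.{u, v} X) (q q' : B.State) : B.State → B.State → Prop :=
  fun s t => s = q ∧ t = q'

/-! ### Elementary expansions -/

/-- The linear automaton of the word `w`, with the positions `0, …, |w|` in `w` (that is, its
prefixes) as states. -/
def lin {A : Type u} (w : List (Letter A)) : Automaton.{u, 0} (Letter A) where
  State := Fin (w.length + 1)
  init := 0
  term := Fin.last w.length
  edge p x q :=
    (q.val = p.val + 1 ∧ w[p.val]? = some x) ∨ (p.val = q.val + 1 ∧ w[q.val]? = some x.inv)

/-- The disjoint union of `B` and the linear automaton of `w`; initial and terminal state are those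
of `B`. -/
def sumLin {A : Type u} (B : Automaton.{u, v} (Letter A)) (w : List (Letter A)) :
    Automaton.{u, v} (Letter A) where
  State := B.State ⊕ (lin w).State
  init := Sum.inl B.init
  term := Sum.inl B.term
  edge s x t :=
    match s, t with
    | Sum.inl p, Sum.inl q => B.edge p x q
    | Sum.inr p, Sum.inr q => (lin w).edge p x q
    | _, _ => False

/-- The identifications that glue the ends of the linear automaton of `w` to `q₁` and `q₂`. -/
inductive Glue {A : Type u} (B : Automaton.{u, v} (Letter A)) (q₁ q₂ : B.State)
    (w : List (Letter A)) : (B.sumLin w).State → (B.sumLin w).State → Prop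
  | left : Glue B q₁ q₂ w (Sum.inl q₁) (Sum.inr (lin w).init)
  | right : Glue B q₁ q₂ w (Sum.inl q₂) (Sum.inr (lin w).term)

/-- `B` with a new path from `q₁` to `q₂` labelled `w` (and the inverse path) added: the inner
states of the path are new. For the empty word, `q₁` and `q₂` become identified. -/
def addPath {A : Type u} (B : Automaton.{u, v} (Letter A)) (q₁ q₂ : B.State)
    (w : List (Letter A)) : Automaton.{u, v} (Letter A) :=
  (B.sumLin w).quot (Glue B q₁ q₂ w)

/-- The canonical morphism from `B` to `B` with a path added. -/
def toAddPath {A : Type u} (B : Automaton.{u, v} (Letter A)) (q₁ q₂ : B.State)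
    (w : List (Letter A)) : Hom B (B.addPath q₁ q₂ w) where
  toFun p := Quot.mk _ (Sum.inl p)
  map_init := rfl
  map_term := rfl
  map_edge p _ q h := ⟨Sum.inl p, Sum.inl q, rfl, rfl, h⟩

/-! ### The closure -/

/-- The morphisms of Stephen's system with respect to `R`: the finite composites of elementary
expansions (add a path `q₁ → q₂` labelled `u` where there is a path `q₁ → q₂` labelled `v`, with
`(u, v) ∈ R` or `(v, u) ∈ R`), of foldings of two edges (identify `q` and `q'` where `q ← p → q'`
carry the same label), and of isomorphisms. -/
inductive StephenMap {A : Type u} (R : Set (Word A × Word A)) :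
    ∀ {C D : Automaton.{u, v} (Letter A)}, Hom C D → Prop
  | expansion (C : Automaton.{u, v} (Letter A)) (q₁ q₂ : C.State) (u v : Word A) :
      (u, v) ∈ R ∨ (v, u) ∈ R → C.Path q₁ v.toList q₂ →
        StephenMap R (C.toAddPath q₁ q₂ u.toList)
  | folding (C : Automaton.{u, v} (Letter A)) (p q q' : C.State) (x : Letter A) :
      C.edge p x q → C.edge p x q' → StephenMap R (C.toQuot (C.Single q q'))
  | iso {C D : Automaton.{u, v} (Letter A)} (e : Iso C D) : StephenMap R e.toHom
  | comp {C D E : Automaton.{u, v} (Letter A)} {f : Hom C D} {g : Hom D E} :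
      StephenMap R f → StephenMap R g → StephenMap R (f.comp g)

/-- The objects of Stephen's directed system of `B` with respect to `R`: the automata obtained from
`B` by a finite sequence of elementary expansions and foldings, together with the resulting
morphism from `B`. -/
structure StephenObj {A : Type u} (R : Set (Word A × Word A))
    (B : Automaton.{u, v} (Letter A)) : Type (max u (v + 1)) where
  aut : Automaton.{u, v} (Letter A)
  map : Hom B aut
  isMap : StephenMap R map

/-- The object `B` itself of its directed system. -/
def StephenObj.base {A : Type u} (R : Set (Word A × Word A)) (B : Automaton.{u, v} (Letter A)) :
    StephenObj R B where
  aut := B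
  map := Iso.toHom ⟨Equiv.refl _, rfl, rfl, fun _ _ _ => Iff.rfl⟩
  isMap := StephenMap.iso _

/-- The identifications that define the colimit: a state is identified with its image under any
morphism of the directed system. -/
inductive ColimRel {A : Type u} (R : Set (Word A × Word A)) (B : Automaton.{u, v} (Letter A)) :
    (Σ O : StephenObj R B, O.aut.State) → (Σ O : StephenObj R B, O.aut.State) → Prop
  | step (O P : StephenObj R B) (h : Hom O.aut P.aut) (hh : StephenMap R h)
      (comm : O.map.comp h = P.map) (s : O.aut.State) :
      ColimRel R B ⟨O, s⟩ ⟨P, h.toFun s⟩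

/-- The closure `Cl_R(B)`: the colimit of the directed system of all the automata obtained from `B`
by finite sequences of elementary expansions and foldings. Its states are those of the objects of
the system modulo the morphisms of the system, and its transitions are the images of the
transitions of the objects. -/
def closure {A : Type u} (R : Set (Word A × Word A)) (B : Automaton.{u, v} (Letter A)) :
    Automaton.{u, max u (v + 1)} (Letter A) where
  State := Quot (ColimRel R B)
  init := Quot.mk _ ⟨StephenObj.base R B, B.init⟩
  term := Quot.mk _ ⟨StephenObj.base R B, B.term⟩
  edge S x T := ∃ (O : StephenObj R B) (s t : O.aut.State),
    Quot.mk _ ⟨O, s⟩ = S ∧ Quot.mk _ ⟨O, t⟩ = T ∧ O.aut.edge s x t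

/-! ### Contraction -/

/-- The automaton on the alphabet without `a`, `a⁻¹` obtained by identifying `p` and `q` for each
transition `p → q` labelled `a` and erasing the loops labelled `a` and `a⁻¹` that result. -/
def collapse {A : Type u} (a : A) (B : Automaton.{u, v} (Letter A)) :
    Automaton.{u, v} (Letter {b : A // b ≠ a}) where
  State := (B.quot fun p q => B.edge p (a, true) q).State
  init := (B.quot fun p q => B.edge p (a, true) q).init
  term := (B.quot fun p q => B.edge p (a, true) q).term
  edge P x Q := (B.quot fun p q => B.edge p (a, true) q).edge P (x.1.val, x.2) Q

/-- The `a`-contracted automaton `χ_a(B)`. -/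
def contract {A : Type u} (a : A) (B : Automaton.{u, v} (Letter A)) :
    Automaton.{u, v} (Letter {b : A // b ≠ a}) :=
  (B.collapse a).fold

end Automaton

/-! ## Schützenberger automata -/

theorem greenR_self_inv {A : Type u} (R : Set (Word A × Word A)) (w : Word A) :
    GreenR (cls R (w * w.inv)) (cls R w) := by
  refine ⟨⟨cls R w.inv, rfl⟩, ⟨cls R w, ?_⟩⟩
  have h : presCon R (w * w.inv * w) w :=
    ConGen.Rel.of _ _ (Or.inl (ConGen.Rel.of _ _ (VagnerRel.regular w)))
  exact ((presCon R).eq.2 h).symm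

/-- The Schützenberger automaton `𝒜(w)` with respect to `Inv⟨A | R⟩`: the subgraph of the Cayley
graph induced by the `𝓡`-class of the class of `w`, with initial state the class of `w w⁻¹` and
terminal state the class of `w`. -/
def schutzenberger {A : Type u} (R : Set (Word A × Word A)) (w : Word A) :
    Automaton.{u, u} (Letter A) where
  State := {m : PresMonoid R // GreenR m (cls R w)}
  init := ⟨cls R (w * w.inv), greenR_self_inv R w⟩
  term := ⟨cls R w, ⟨1, (mul_one _).symm⟩, ⟨1, (mul_one _).symm⟩⟩
  edge m x n := n.val = m.val * cls R (FreeMonoid.of x)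

/-! ## Erasing a letter -/

open Classical in
/-- The homomorphism `θ` erasing the letters `a` and `a⁻¹` and fixing all others. -/
noncomputable def erase {A : Type u} (a : A) : Word A →* Word {b : A // b ≠ a} :=
  FreeMonoid.lift fun x =>
    if h : x.1 = a then 1 else FreeMonoid.of ((⟨x.1, h⟩ : {b : A // b ≠ a}), x.2)

/-- The relation `R θ̄ = {(uθ, vθ) | (u, v) ∈ R}`. -/
def eraseRel {A : Type u} (a : A) (R : Set (Word A × Word A)) :
    Set (Word {b : A // b ≠ a} × Word {b : A // b ≠ a}) :=
  Prod.map (erase a) (erase a) '' R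

end InvPres

/-!
Call an automaton closed if it is deterministic, its transitions come in mutually inverse pairs, and
elementary expansions add no new paths to it. In a closed automaton, words that are equal in
`Inv⟨A | R⟩` label the same paths. Therefore a morphism to `𝒜(w)` from an accessible closed
automaton accepting `w` reflects paths and is bijective.

Let `B` be accessible with mutually inverse transitions, accept `w` and have a morphism to `𝒜(w)`.
The morphism extends to `Cl_R(B)` because `𝒜(w)` is itself closed, so `Cl_R(B) ≅ 𝒜(w)` as soon as
`Cl_R(B)` is closed. This holds because Stephen's system is directed: its generating morphisms are
stable under pushouts, so two morphisms with the same source have a pushout in the system.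

The automaton `χ_a(𝒜(w))` satisfies these conditions for `wθ_a`: a path labelled `u` becomes a path
labelled `uθ_a`, and the homomorphism of presented monoids induced by `θ_a` gives the morphism to
`𝒜(wθ_a)`.
-/

namespace InvPres

theorem Letter.inv_inv {A : Type u} (x : Letter A) : x.inv.inv = x := by
  simp only [Letter.inv, Bool.not_not]

theorem Word.inv_of {A : Type u} (x : Letter A) :
    Word.inv (FreeMonoid.of x) = FreeMonoid.of x.inv := rfl

theorem Word.inv_mul {A : Type u} (u v : Word A) : (u * v).inv = v.inv * u.inv := by
  simp only [Word.inv, FreeMonoid.toList_mul, List.map_append, List.reverse_append,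
    FreeMonoid.ofList_append]

theorem Word.inv_inv {A : Type u} (w : Word A) : w.inv.inv = w := by
  induction w using FreeMonoid.inductionOn' with
  | one => rfl
  | of_mul x w ih => rw [Word.inv_mul, Word.inv_mul, ih, Word.inv_of, Word.inv_of, Letter.inv_inv]

namespace Automaton

/-! ### Paths and morphisms -/

section Paths

variable {X : Type u} {B : Automaton.{u, v} X} {C : Automaton.{u, v'} X}

theorem path_append {p q : B.State} {w₁ w₂ : List X} :
    B.Path p (w₁ ++ w₂) q ↔ ∃ r, B.Path p w₁ r ∧ B.Path r w₂ q := by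
  induction w₁ generalizing p with
  | nil => simp only [List.nil_append, Path, exists_eq_left']
  | cons x w ih =>
    simp only [List.cons_append, Path, ih]
    grind

theorem path_singleton {p q : B.State} {x : X} : B.Path p [x] q ↔ B.edge p x q := by
  simp only [Path, exists_eq_right]

theorem Path.map (f : B.State → C.State)
    (hf : ∀ p x q, B.edge p x q → C.edge (f p) x (f q)) {p q : B.State} {w : List X}
    (h : B.Path p w q) : C.Path (f p) w (f q) := by
  induction w generalizing p with
  | nil => exact congrArg f h
  | cons x w ih =>
    obtain ⟨r, hpr, hrq⟩ := h
    exact ⟨f r, hf _ _ _ hpr, ih hrq⟩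

theorem Path.exists_seq {p q : B.State} {w : List X} (h : B.Path p w q) :
    ∃ g : ℕ → B.State, g 0 = p ∧ g w.length = q ∧
      ∀ i x, w[i]? = some x → B.edge (g i) x (g (i + 1)) := by
  induction w generalizing p with
  | nil => exact ⟨fun _ => p, rfl, h, by simp⟩
  | cons x w ih =>
    obtain ⟨r, hpr, hrq⟩ := h
    obtain ⟨g, hg₀, hg_last, hg⟩ := ih hrq
    refine ⟨fun i => Nat.casesOn i p g, rfl, hg_last, ?_⟩
    rintro (_ | i) y hy
    · obtain rfl : x = y := by simpa using hy
      simpa [hg₀] using hpr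
    · exact hg i y (by simpa using hy)

theorem Hom.map_path (f : Hom B C) {p q : B.State} {w : List X} (h : B.Path p w q) :
    C.Path (f.toFun p) w (f.toFun q) :=
  h.map f.toFun f.map_edge

attribute [ext] Hom

theorem Hom.congr_toFun {f g : Hom B C} (h : f = g) (s : B.State) : f.toFun s = g.toFun s := by
  rw [h]

/-- The inverse of an isomorphism of automata. -/
def Iso.symm (e : Iso B C) : Iso C B where
  toEquiv := e.toEquiv.symm
  map_init := by rw [← e.map_init, Equiv.symm_apply_apply]
  map_term := by rw [← e.map_term, Equiv.symm_apply_apply]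
  map_edge p x q := by rw [e.map_edge, Equiv.apply_symm_apply, Equiv.apply_symm_apply]

/-- The morphism from a quotient induced by a morphism that respects the identifications. -/
def quotDesc (r : B.State → B.State → Prop) (f : Hom B C)
    (h : ∀ p q, r p q → f.toFun p = f.toFun q) : Hom (B.quot r) C where
  toFun := Quot.lift f.toFun h
  map_init := f.map_init
  map_term := f.map_term
  map_edge := by
    rintro _ x _ ⟨p, q, rfl, rfl, e⟩
    exact f.map_edge _ _ _ e

/-- Transitions with the same origin and label have the same end. -/
def Deterministic (B : Automaton.{u, v} X) : Prop :=
  ∀ ⦃p x q q'⦄, B.edge p x q → B.edge p x q' → q = q'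

theorem Deterministic.path_unique (hB : B.Deterministic) {p q q' : B.State} {w : List X}
    (h : B.Path p w q) (h' : B.Path p w q') : q = q' := by
  induction w generalizing p with
  | nil => exact h.symm.trans h'
  | cons x w ih =>
    obtain ⟨r, hpr, hrq⟩ := h
    obtain ⟨r', hpr', hrq'⟩ := h'
    obtain rfl := hB hpr hpr'
    exact ih hrq hrq'

theorem Deterministic.map_eq_of_foldRel (hC : C.Deterministic) (f : Hom B C) {p q : B.State}
    (h : B.FoldRel p q) : f.toFun p = f.toFun q := by
  induction h with
  | refl => rfl
  | symm _ ih => exact ih.symm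
  | trans _ _ ih₁ ih₂ => exact ih₁.trans ih₂
  | fold x _ e₁ e₂ ih => exact hC (ih ▸ f.map_edge _ _ _ e₁) (f.map_edge _ _ _ e₂)

/-- Every state can be reached from the initial state. -/
def Accessible (B : Automaton.{u, v} X) : Prop :=
  ∀ q, ∃ w, B.Path B.init w q

theorem Accessible.of_surjective (hB : B.Accessible) (f : Hom B C)
    (hf : Function.Surjective f.toFun) : C.Accessible := by
  intro q
  obtain ⟨p, rfl⟩ := hf q
  obtain ⟨w, hw⟩ := hB p
  exact ⟨w, f.map_init ▸ f.map_path hw⟩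

theorem Accessible.hom_unique (hB : B.Accessible) (hC : C.Deterministic) (f g : Hom B C) :
    f = g := by
  ext s
  obtain ⟨w, hw⟩ := hB s
  exact hC.path_unique (f.map_init ▸ f.map_path hw) (g.map_init ▸ g.map_path hw)

end Paths

/-! ### Inverse automata -/

section Inverse

variable {A : Type u} {B : Automaton.{u, v} (Letter A)}

/-- Transitions come in mutually inverse pairs. -/
def Involutive (B : Automaton.{u, v} (Letter A)) : Prop :=
  ∀ ⦃p x q⦄, B.edge p x q → B.edge q x.inv p

theorem Involutive.quot (hB : B.Involutive) (r : B.State → B.State → Prop) :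
    (B.quot r).Involutive := by
  rintro _ x _ ⟨p, q, rfl, rfl, e⟩
  exact ⟨q, p, rfl, rfl, hB e⟩

theorem Involutive.of_iso {C : Automaton.{u, v'} (Letter A)} (hB : B.Involutive) (e : Iso B C) :
    C.Involutive :=
  fun _ _ _ h => (e.symm.map_edge _ _ _).2 (hB ((e.symm.map_edge _ _ _).1 h))

theorem involutive_lin (w : List (Letter A)) : (lin w).Involutive := by
  rintro p x q (⟨hpq, hx⟩ | h)
  · exact Or.inr ⟨hpq, by rwa [Letter.inv_inv]⟩
  · exact Or.inl h

theorem Involutive.sumLin (hB : B.Involutive) (w : List (Letter A)) :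
    (B.sumLin w).Involutive := by
  rintro (p | p) x (q | q) h
  · exact hB h
  · exact h
  · exact h
  · exact involutive_lin w h

theorem Involutive.path_inv (hB : B.Involutive) {p q : B.State} {w : Word A}
    (h : B.Path p w.toList q) : B.Path q w.inv.toList p := by
  induction w using FreeMonoid.inductionOn' generalizing p with
  | one => exact Eq.symm h
  | of_mul x w ih =>
    obtain ⟨r, hpr, hrq⟩ := h
    rw [Word.inv_mul, FreeMonoid.toList_mul, path_append]
    exact ⟨r, ih hrq, path_singleton.2 (hB hpr)⟩

theorem Involutive.exists_lin_map (hB : B.Involutive) {p q : B.State} {w : List (Letter A)}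
    (h : B.Path p w q) :
    ∃ g : (lin w).State → B.State, g (lin w).init = p ∧ g (lin w).term = q ∧
      ∀ i x j, (lin w).edge i x j → B.edge (g i) x (g j) := by
  obtain ⟨s, hs₀, hs_last, hs⟩ := h.exists_seq
  refine ⟨fun i => s i.val, hs₀, hs_last, ?_⟩
  rintro i x j (⟨hij, hx⟩ | ⟨hij, hx⟩)
  · have e : B.edge (s i.val) x (s (i.val + 1)) := hs _ _ hx
    rwa [← hij] at e
  · have e : B.edge (s (j.val + 1)) x.inv.inv (s j.val) := hB (hs _ _ hx)
    rwa [← hij, Letter.inv_inv] at e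

/-- The congruence that relates words labelling the same paths of `B`. -/
def pathCon (B : Automaton.{u, v} (Letter A)) : Con (Word A) where
  r u v := ∀ p q, B.Path p u.toList q ↔ B.Path p v.toList q
  iseqv := ⟨fun _ _ _ => Iff.rfl, fun h p q => (h p q).symm,
    fun h h' p q => (h p q).trans (h' p q)⟩
  mul' h h' p q := by simp only [FreeMonoid.toList_mul, path_append, h _ _, h' _ _]

theorem Deterministic.path_mul_inv_iff (hd : B.Deterministic) (hi : B.Involutive) {p q : B.State}
    {w : Word A} : B.Path p (w * w.inv).toList q ↔ p = q ∧ ∃ r, B.Path p w.toList r := by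
  rw [FreeMonoid.toList_mul, path_append]
  constructor
  · rintro ⟨r, hpr, hrq⟩
    exact ⟨hd.path_unique (hi.path_inv hpr) hrq, r, hpr⟩
  · rintro ⟨rfl, r, hpr⟩
    exact ⟨r, hpr, hi.path_inv hpr⟩

theorem Deterministic.pathCon_of_vagnerRel (hd : B.Deterministic) (hi : B.Involutive)
    {u v : Word A} (h : VagnerRel A u v) : B.pathCon u v := by
  intro p q
  cases h with
  | regular =>
    rw [FreeMonoid.toList_mul, path_append]
    simp only [hd.path_mul_inv_iff hi]
    exact ⟨fun ⟨_, ⟨hpr, _⟩, hrq⟩ => hpr ▸ hrq, fun h => ⟨p, ⟨rfl, q, h⟩, h⟩⟩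
  | commute u v =>
    have path_idempotents (u v : Word A) : B.Path p (u * u.inv * (v * v.inv)).toList q →
        B.Path p (v * v.inv * (u * u.inv)).toList q := by
      rw [FreeMonoid.toList_mul, FreeMonoid.toList_mul (v * v.inv), path_append, path_append]
      simp only [hd.path_mul_inv_iff hi]
      rintro ⟨_, ⟨rfl, hu⟩, rfl, hv⟩
      exact ⟨p, ⟨rfl, hv⟩, rfl, hu⟩
    exact ⟨path_idempotents u v, path_idempotents v u⟩

/-- The inverse automata to which neither foldings nor elementary expansions with respect to `R`
contribute anything new. -/
structure StephenClosed (B : Automaton.{u, v} (Letter A)) (R : Set (Word A × Word A)) : Prop where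
  deterministic : B.Deterministic
  involutive : B.Involutive
  path_of_mem : ∀ ⦃p q u v⦄, (u, v) ∈ R ∨ (v, u) ∈ R → B.Path p v.toList q → B.Path p u.toList q

end Inverse

end Automaton

/-! ### Presented monoids -/

section PresMonoid

variable {A : Type u} {R : Set (Word A × Word A)}

theorem presCon_le {c : Con (Word A)} (hV : ∀ u v, VagnerRel A u v → c u v)
    (hR : ∀ u v, (u, v) ∈ R → c u v) : presCon R ≤ c :=
  Con.conGen_le.2 fun u v h => h.elim (fun h => Con.conGen_le.2 hV h) (hR u v)

theorem cls_mul (u v : Word A) : cls R (u * v) = cls R u * cls R v := rfl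

theorem cls_eq_iff {u v : Word A} : cls R u = cls R v ↔ presCon R u v := (presCon R).eq

theorem cls_surjective : Function.Surjective (cls R) := Quotient.exists_rep

theorem cls_eq_of_vagnerRel {u v : Word A} (h : VagnerRel A u v) : cls R u = cls R v :=
  cls_eq_iff.2 (ConGen.Rel.of _ _ (Or.inl (ConGen.Rel.of _ _ h)))

theorem cls_eq_of_mem {u v : Word A} (h : (u, v) ∈ R) : cls R u = cls R v :=
  cls_eq_iff.2 (ConGen.Rel.of _ _ (Or.inr h))

theorem cls_mul_inv_mul (w : Word A) : cls R w * cls R w.inv * cls R w = cls R w :=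
  cls_eq_of_vagnerRel (VagnerRel.regular w)

theorem cls_inv_mul_comm_mul_inv (u v : Word A) :
    cls R u.inv * cls R u * (cls R v * cls R v.inv) =
      cls R v * cls R v.inv * (cls R u.inv * cls R u) := by
  have h := cls_eq_of_vagnerRel (R := R) (VagnerRel.commute u.inv v)
  rwa [Word.inv_inv] at h

theorem Automaton.StephenClosed.path_of_cls_eq {B : Automaton.{u, v} (Letter A)}
    (hB : B.StephenClosed R) {u v : Word A} (h : cls R u = cls R v) {p q : B.State}
    (hu : B.Path p u.toList q) : B.Path p v.toList q := by
  have presCon_le_pathCon : presCon R ≤ B.pathCon :=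
    presCon_le (fun _ _ => hB.deterministic.pathCon_of_vagnerRel hB.involutive)
      fun _ _ h _ _ => ⟨hB.path_of_mem (Or.inr h), hB.path_of_mem (Or.inl h)⟩
  exact (presCon_le_pathCon (cls_eq_iff.1 h) p q).1 hu

theorem GreenR.symm {M : Type*} [Monoid M] {m n : M} (h : GreenR m n) : GreenR n m := ⟨h.2, h.1⟩

theorem GreenR.trans {M : Type*} [Monoid M] {m n k : M} (h : GreenR m n) (h' : GreenR n k) :
    GreenR m k := by
  obtain ⟨⟨x, rfl⟩, y, hy⟩ := h
  obtain ⟨⟨x', rfl⟩, y', hy'⟩ := h'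
  exact ⟨⟨x' * x, mul_assoc _ _ _⟩, y * y', by rw [← mul_assoc, ← hy, ← hy']⟩

theorem GreenR.map {M N : Type*} [Monoid M] [Monoid N] (f : M →* N) {m n : M} (h : GreenR m n) :
    GreenR (f m) (f n) := by
  obtain ⟨⟨x, hx⟩, y, hy⟩ := h
  exact ⟨⟨f x, by rw [← map_mul, ← hx]⟩, f y, by rw [← map_mul, ← hy]⟩

theorem GreenR.mul_mul_eq_self {M : Type*} [Monoid M] {m m' x x' : M} (h : GreenR m (m * x))
    (hm : m * m' * m = m) (hx : x * x' * x = x)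
    (hcomm : m' * m * (x * x') = x * x' * (m' * m)) : m * x * x' = m := by
  obtain ⟨y, hy⟩ := h.1
  calc m * x * x' = m * m' * m * x * x' := by rw [hm]
    _ = m * (m' * m * (x * x')) := by simp only [mul_assoc]
    _ = m * (x * x') * m' * m := by rw [hcomm]; simp only [mul_assoc]
    _ = m * (x * x') * m' * (m * x * y) := by rw [← hy]
    _ = m * (x * x' * (m' * m)) * x * y := by simp only [mul_assoc]
    _ = m * m' * m * (x * x' * x) * y := by rw [← hcomm]; simp only [mul_assoc]
    _ = m := by rw [hm, hx, ← hy]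

end PresMonoid

/-! ### Morphisms to Schützenberger automata -/

section Schutzenberger

open Automaton

variable {A : Type u} {R : Set (Word A × Word A)} {w : Word A}

theorem greenR_of_state (p q : (schutzenberger R w).State) : GreenR p.val q.val :=
  p.2.trans q.2.symm

theorem path_schutzenberger_iff {p q : (schutzenberger R w).State} {u : Word A} :
    (schutzenberger R w).Path p u.toList q ↔ q.val = p.val * cls R u := by
  induction u using FreeMonoid.inductionOn' generalizing p with
  | one =>
    change p = q ↔ q.val = p.val * 1
    rw [mul_one]
    exact eq_comm.trans Subtype.ext_iff
  | of_mul x u ih =>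
    change (∃ r, r.val = p.val * cls R (FreeMonoid.of x) ∧
      (schutzenberger R w).Path r u.toList q) ↔ _
    simp only [ih]
    rw [cls_mul, ← mul_assoc]
    constructor
    · rintro ⟨r, hr, hq⟩
      rw [hq, hr]
    · intro hq
      obtain ⟨y, hy⟩ := (greenR_of_state p q).1
      have hpx : GreenR (p.val * cls R (FreeMonoid.of x)) p.val :=
        ⟨⟨_, rfl⟩, cls R u * y, by rwa [← mul_assoc, ← hq]⟩
      exact ⟨⟨_, hpx.trans p.2⟩, rfl, hq⟩

theorem stephenClosed_schutzenberger : (schutzenberger R w).StephenClosed R where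
  deterministic _ _ _ _ h h' := Subtype.ext (Eq.trans h h'.symm)
  involutive := by
    rintro p x ⟨_, hq⟩ rfl
    obtain ⟨u, hu⟩ := cls_surjective p.val
    have hpx : GreenR p.val (p.val * cls R (FreeMonoid.of x)) := greenR_of_state p ⟨_, hq⟩
    change p.val = p.val * cls R (FreeMonoid.of x) * cls R (Word.inv (FreeMonoid.of x))
    rw [← hu] at hpx ⊢
    exact (hpx.mul_mul_eq_self (cls_mul_inv_mul _) (cls_mul_inv_mul _)
      (cls_inv_mul_comm_mul_inv _ _)).symm
  path_of_mem := by
    intro p q u v huv h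
    rw [path_schutzenberger_iff] at h ⊢
    rwa [huv.elim cls_eq_of_mem fun h => (cls_eq_of_mem h).symm]

theorem cls_mul_inv_mul_state (m : (schutzenberger R w).State) :
    cls R (w * w.inv) * m.val = m.val := by
  obtain ⟨x, hx⟩ := m.2.1
  rw [hx, ← mul_assoc, cls_mul, cls_mul_inv_mul]

theorem path_schutzenberger_of_cls_eq {m : (schutzenberger R w).State} {u : Word A}
    (h : cls R u = m.val) : (schutzenberger R w).Path (schutzenberger R w).init u.toList m :=
  path_schutzenberger_iff.2 (h ▸ (cls_mul_inv_mul_state m).symm)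

theorem accessible_schutzenberger : (schutzenberger R w).Accessible := fun m =>
  (cls_surjective m.val).imp fun _ => path_schutzenberger_of_cls_eq

variable {C : Automaton.{u, v} (Letter A)}

theorem val_eq_of_path (φ : Hom C (schutzenberger R w)) {u : Word A} {c : C.State}
    (h : C.Path C.init u.toList c) : (φ.toFun c).val = cls R (w * w.inv * u) :=
  path_schutzenberger_iff.1 (φ.map_init ▸ φ.map_path h)

theorem path_of_path_schutzenberger (hC : C.StephenClosed R) (ha : C.Accessible)
    (hw : C.Path C.init w.toList C.term) (φ : Hom C (schutzenberger R w)) {c d : C.State}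
    {u : Word A} (h : (schutzenberger R w).Path (φ.toFun c) u.toList (φ.toFun d)) :
    C.Path c u.toList d := by
  obtain ⟨y, hy⟩ : ∃ y : Word A, C.Path C.init y.toList c := ha c
  obtain ⟨z, hz⟩ : ∃ z : Word A, C.Path C.init z.toList d := ha d
  have loop : C.Path C.init (w * w.inv).toList C.init :=
    (hC.deterministic.path_mul_inv_iff hC.involutive).2 ⟨rfl, _, hw⟩
  have hcls : cls R (w * w.inv * z) = cls R (w * w.inv * y * u) := by
    rw [← val_eq_of_path φ hz, cls_mul, ← val_eq_of_path φ hy]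
    exact path_schutzenberger_iff.1 h
  obtain ⟨c', hc', hd⟩ := path_append.1 (hC.path_of_cls_eq hcls (path_append.2 ⟨_, loop, hz⟩))
  obtain rfl := hC.deterministic.path_unique hc' (path_append.2 ⟨_, loop, hy⟩)
  exact hd

theorem surjective_to_schutzenberger (hC : C.StephenClosed R)
    (hw : C.Path C.init w.toList C.term) (φ : Hom C (schutzenberger R w)) :
    Function.Surjective φ.toFun := by
  intro m
  obtain ⟨y, hy⟩ := cls_surjective m.val
  obtain ⟨n, hz⟩ := m.2.2
  obtain ⟨z, rfl⟩ := cls_surjective n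
  rw [← hy, ← cls_mul] at hz
  obtain ⟨c, hc, -⟩ := path_append.1 (hC.path_of_cls_eq hz hw)
  refine ⟨c, Subtype.ext ?_⟩
  rw [val_eq_of_path φ hc, cls_mul, hy, cls_mul_inv_mul_state]

theorem nonempty_iso_schutzenberger (hC : C.StephenClosed R) (ha : C.Accessible)
    (hw : C.Path C.init w.toList C.term) (φ : Hom C (schutzenberger R w)) :
    Nonempty (Iso C (schutzenberger R w)) := by
  have reflects {c d : C.State} {u : Word A} :
      (schutzenberger R w).Path (φ.toFun c) u.toList (φ.toFun d) → C.Path c u.toList d :=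
    path_of_path_schutzenberger hC ha hw φ
  have inj : Function.Injective φ.toFun := fun _ _ h => reflects (u := 1) h
  exact ⟨Equiv.ofBijective _ ⟨inj, surjective_to_schutzenberger hC hw φ⟩, φ.map_init, φ.map_term,
    fun p x q => ⟨φ.map_edge p x q, fun h =>
      path_singleton.1 (reflects (u := FreeMonoid.of x) (path_singleton.2 h))⟩⟩

end Schutzenberger

namespace Automaton

/-! ### Pushouts along the morphisms of Stephen's system -/

section Category

variable {X : Type u}

/-- The category of automata over `X` and their morphisms. -/
instance category : CategoryTheory.Category (Automaton.{u, v} X) where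
  Hom := Hom
  id _ := ⟨id, rfl, rfl, fun _ _ _ h => h⟩
  comp := Hom.comp
  id_comp _ := rfl
  comp_id _ := rfl
  assoc _ _ _ := rfl

open CategoryTheory Limits

/-- An isomorphism in the category of automata as an isomorphism of automata. -/
def isoOfCategoryIso {C D : Automaton.{u, v} X} (e : C ≅ D) : Iso C D where
  toEquiv :=
    ⟨e.hom.toFun, e.inv.toFun, Hom.congr_toFun e.hom_inv_id, Hom.congr_toFun e.inv_hom_id⟩
  map_init := e.hom.map_init
  map_term := e.hom.map_term
  map_edge p x q := by
    have hinv (s : C.State) : e.inv.toFun (e.hom.toFun s) = s := Hom.congr_toFun e.hom_inv_id s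
    refine ⟨e.hom.map_edge p x q, fun h => ?_⟩
    rw [← hinv p, ← hinv q]
    exact e.inv.map_edge _ _ _ h

theorem Iso.isIso_toHom {C D : Automaton.{u, v} X} (i : Iso C D) :
    IsIso (C := Automaton.{u, v} X) i.toHom :=
  ⟨i.symm.toHom, Hom.ext (funext i.toEquiv.symm_apply_apply),
    Hom.ext (funext i.toEquiv.apply_symm_apply)⟩

/-- The morphism of quotients induced by `g`. -/
def quotMap {C E : Automaton.{u, v} X} (g : Hom C E) (r : C.State → C.State → Prop) :
    Hom (C.quot r) (E.quot (Relation.Map r g.toFun g.toFun)) :=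
  quotDesc r (g.comp (E.toQuot _)) fun p q h => Quot.sound ⟨p, q, h, rfl, rfl⟩

theorem isPushout_toQuot {C E : Automaton.{u, v} X} (g : C ⟶ E) (r : C.State → C.State → Prop) :
    IsPushout (C.toQuot r) g (quotMap g r) (E.toQuot (Relation.Map r g.toFun g.toFun)) := by
  refine ⟨⟨rfl⟩, ⟨PushoutCocone.IsColimit.mk _ (fun s => quotDesc _ s.inr ?_) ?_ ?_ ?_⟩⟩
  · rintro _ _ ⟨p, q, h, rfl, rfl⟩
    have hs := Hom.congr_toFun s.condition
    exact (hs p).symm.trans ((congrArg s.inl.toFun (Quot.sound h)).trans (hs q))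
  · exact fun s => Hom.ext (funext (Quot.ind fun p => (Hom.congr_toFun s.condition p).symm))
  · exact fun _ => rfl
  · exact fun s m _ hm => Hom.ext (funext (Quot.ind (Hom.congr_toFun hm)))

theorem map_single {C : Automaton.{u, v} X} {E : Automaton.{u, v'} X} (g : Hom C E)
    (q q' : C.State) :
    Relation.Map (C.Single q q') g.toFun g.toFun = E.Single (g.toFun q) (g.toFun q') := by
  ext s t
  constructor
  · rintro ⟨_, _, ⟨rfl, rfl⟩, rfl, rfl⟩
    exact ⟨rfl, rfl⟩
  · rintro ⟨rfl, rfl⟩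
    exact ⟨q, q', ⟨rfl, rfl⟩, rfl, rfl⟩

end Category

section AddPath

variable {A : Type u} {B : Automaton.{u, v} (Letter A)} {q₁ q₂ : B.State} {w : List (Letter A)}

/-- The inclusion of the new path into `B` with a path added. -/
def linToAddPath (B : Automaton.{u, v} (Letter A)) (q₁ q₂ : B.State) (w : List (Letter A))
    (i : (lin w).State) : (B.addPath q₁ q₂ w).State :=
  Quot.mk _ (Sum.inr i)

theorem edge_linToAddPath (i : (lin w).State) (x : Letter A) (j : (lin w).State)
    (h : (lin w).edge i x j) :
    (B.addPath q₁ q₂ w).edge (linToAddPath B q₁ q₂ w i) x (linToAddPath B q₁ q₂ w j) :=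
  ⟨Sum.inr i, Sum.inr j, rfl, rfl, h⟩

theorem toAddPath_left :
    (B.toAddPath q₁ q₂ w).toFun q₁ = linToAddPath B q₁ q₂ w (lin w).init :=
  Quot.sound Glue.left

theorem toAddPath_right :
    (B.toAddPath q₁ q₂ w).toFun q₂ = linToAddPath B q₁ q₂ w (lin w).term :=
  Quot.sound Glue.right

/-- The morphism from `B` with a path added that is given on `B` and on the new path. -/
def addPathDesc {Z : Automaton.{u, v'} (Letter A)} (f : Hom B Z) (g : (lin w).State → Z.State)
    (hg : ∀ i x j, (lin w).edge i x j → Z.edge (g i) x (g j))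
    (hleft : f.toFun q₁ = g (lin w).init) (hright : f.toFun q₂ = g (lin w).term) :
    Hom (B.addPath q₁ q₂ w) Z :=
  quotDesc (B := B.sumLin w) (Glue B q₁ q₂ w)
    { toFun := Sum.elim f.toFun g
      map_init := f.map_init
      map_term := f.map_term
      map_edge := by
        rintro (p | p) x (q | q) h
        · exact f.map_edge _ _ _ h
        · exact h.elim
        · exact h.elim
        · exact hg _ _ _ h }
    (by
      rintro _ _ (_ | _)
      · exact hleft
      · exact hright)

theorem addPath_hom_ext {Z : Automaton.{u, v'} (Letter A)} {f g : Hom (B.addPath q₁ q₂ w) Z}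
    (hB : ∀ p, f.toFun ((B.toAddPath q₁ q₂ w).toFun p) = g.toFun ((B.toAddPath q₁ q₂ w).toFun p))
    (hlin : ∀ i, f.toFun (linToAddPath B q₁ q₂ w i) = g.toFun (linToAddPath B q₁ q₂ w i)) :
    f = g :=
  Hom.ext (funext (Quot.ind (Sum.rec hB hlin)))

/-- The morphism of automata with a path added induced by `g`. -/
def addPathMap {E : Automaton.{u, v} (Letter A)} (g : Hom B E) (q₁ q₂ : B.State)
    (w : List (Letter A)) :
    Hom (B.addPath q₁ q₂ w) (E.addPath (g.toFun q₁) (g.toFun q₂) w) :=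
  addPathDesc (g.comp (E.toAddPath (g.toFun q₁) (g.toFun q₂) w)) (linToAddPath E _ _ w)
    edge_linToAddPath toAddPath_left toAddPath_right

open CategoryTheory Limits in
theorem isPushout_toAddPath {E : Automaton.{u, v} (Letter A)} (g : B ⟶ E) (q₁ q₂ : B.State)
    (w : List (Letter A)) :
    IsPushout (B.toAddPath q₁ q₂ w) g (addPathMap g q₁ q₂ w)
      (E.toAddPath (g.toFun q₁) (g.toFun q₂) w) := by
  refine ⟨⟨rfl⟩, ⟨PushoutCocone.IsColimit.mk _ (fun s => addPathDesc s.inr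
    (fun i => s.inl.toFun (linToAddPath B q₁ q₂ w i))
    (fun i x j h => s.inl.map_edge _ _ _ (edge_linToAddPath i x j h)) ?_ ?_) ?_ ?_ ?_⟩⟩
  · exact (Hom.congr_toFun s.condition q₁).symm.trans (congrArg s.inl.toFun toAddPath_left)
  · exact (Hom.congr_toFun s.condition q₂).symm.trans (congrArg s.inl.toFun toAddPath_right)
  · exact fun s => addPath_hom_ext (fun p => (Hom.congr_toFun s.condition p).symm) fun _ => rfl
  · exact fun _ => rfl
  · exact fun s m hl hr => addPath_hom_ext (Hom.congr_toFun hr) fun i =>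
      Hom.congr_toFun hl (linToAddPath B q₁ q₂ w i)

theorem path_lin_take (w : List (Letter A)) (i : (lin w).State) :
    (lin w).Path (lin w).init (w.take i.val) i := by
  induction i using Fin.induction with
  | zero => rfl
  | succ i ih =>
    have hstep : w.take i.succ.val = w.take i.val ++ [w[i]] := by
      simp only [Fin.val_succ, Fin.getElem_fin, List.take_append_getElem]
    rw [hstep]
    exact path_append.2
      ⟨_, ih, path_singleton.2 (Or.inl ⟨rfl, List.getElem?_eq_getElem i.isLt⟩)⟩

theorem path_linToAddPath (i : (lin w).State) :
    (B.addPath q₁ q₂ w).Path ((B.toAddPath q₁ q₂ w).toFun q₁) (w.take i.val)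
      (linToAddPath B q₁ q₂ w i) :=
  toAddPath_left ▸ (path_lin_take w i).map _ edge_linToAddPath

theorem path_toAddPath :
    (B.addPath q₁ q₂ w).Path ((B.toAddPath q₁ q₂ w).toFun q₁) w
      ((B.toAddPath q₁ q₂ w).toFun q₂) := by
  have h := path_linToAddPath (B := B) (q₁ := q₁) (q₂ := q₂) (lin w).term
  rwa [← toAddPath_right, show w.take (lin w).term.val = w from List.take_length] at h

theorem Accessible.addPath (hB : B.Accessible) : (B.addPath q₁ q₂ w).Accessible := by
  rintro ⟨q | i⟩
  · exact (hB q).imp fun _ => (B.toAddPath q₁ q₂ w).map_path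
  · obtain ⟨y, hy⟩ := hB q₁
    exact ⟨_, path_append.2 ⟨_, (B.toAddPath q₁ q₂ w).map_path hy, path_linToAddPath i⟩⟩

end AddPath

section StephenMap

variable {A : Type u} {R : Set (Word A × Word A)} {C D E : Automaton.{u, v} (Letter A)}

theorem StephenMap.involutive {f : Hom C D} (hf : StephenMap R f) (hC : C.Involutive) :
    D.Involutive := by
  induction hf with
  | expansion => exact (hC.sumLin _).quot _
  | folding => exact hC.quot _
  | iso i => exact hC.of_iso i
  | comp _ _ ih₁ ih₂ => exact ih₂ (ih₁ hC)

theorem StephenMap.accessible {f : Hom C D} (hf : StephenMap R f) (hC : C.Accessible) :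
    D.Accessible := by
  induction hf with
  | expansion => exact hC.addPath
  | folding => exact hC.of_surjective (toQuot _ _) Quot.mk_surjective
  | iso i => exact hC.of_surjective i.toHom i.toEquiv.surjective
  | comp _ _ ih₁ ih₂ => exact ih₂ (ih₁ hC)

theorem StephenMap.exists_extension {f : Hom C D} (hf : StephenMap R f)
    {Z : Automaton.{u, v} (Letter A)} (hZ : Z.StephenClosed R) (g : Hom C Z) :
    ∃ h : Hom D Z, f.comp h = g := by
  induction hf with
  | expansion C q₁ q₂ u v huv hp =>
    obtain ⟨s, hs₁, hs₂, hs⟩ :=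
      hZ.involutive.exists_lin_map (hZ.path_of_mem huv (g.map_path hp))
    exact ⟨addPathDesc g s hs hs₁.symm hs₂.symm, rfl⟩
  | folding C p q q' x h h' =>
    refine ⟨quotDesc _ g ?_, rfl⟩
    rintro _ _ ⟨rfl, rfl⟩
    exact hZ.deterministic (g.map_edge _ _ _ h) (g.map_edge _ _ _ h')
  | iso i =>
    exact ⟨i.symm.toHom.comp g,
      Hom.ext (funext fun s => congrArg g.toFun (i.toEquiv.symm_apply_apply s))⟩
  | comp _ _ ih₁ ih₂ =>
    obtain ⟨h, rfl⟩ := ih₁ g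
    obtain ⟨h', rfl⟩ := ih₂ h
    exact ⟨h', rfl⟩

open CategoryTheory in
theorem StephenMap.of_isIso (f : C ⟶ D) [IsIso f] : StephenMap R f :=
  StephenMap.iso (isoOfCategoryIso (asIso f))

open CategoryTheory in
theorem StephenMap.exists_isPushout {f : C ⟶ D} (hf : StephenMap R f) (g : C ⟶ E) :
    ∃ (F : Automaton.{u, v} (Letter A)) (h : D ⟶ F) (k : E ⟶ F),
      StephenMap R k ∧ IsPushout f g h k := by
  induction hf generalizing E with
  | expansion C q₁ q₂ u v huv hp =>
    exact ⟨_, _, _, StephenMap.expansion E _ _ u v huv (g.map_path hp),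
      isPushout_toAddPath g q₁ q₂ u.toList⟩
  | folding C p q q' x h h' =>
    have hfold := StephenMap.folding (R := R) E _ _ _ x (g.map_edge _ _ _ h) (g.map_edge _ _ _ h')
    rw [← map_single] at hfold
    exact ⟨_, _, _, hfold, isPushout_toQuot g _⟩
  | iso i =>
    have := i.isIso_toHom
    exact ⟨E, inv i.toHom ≫ g, 𝟙 E, StephenMap.of_isIso _, IsPushout.of_horiz_isIso ⟨by simp⟩⟩
  | comp _ _ ih₁ ih₂ =>
    obtain ⟨_, h, k, hk, sq⟩ := ih₁ g
    obtain ⟨_, h', k', hk', sq'⟩ := ih₂ h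
    exact ⟨_, _, _, hk.comp hk', sq.paste_horiz sq'⟩

open CategoryTheory in
/-- Both cobase changes of a span in the system are pushouts of that span, hence isomorphic: this
puts all sides of the square into the system. -/
theorem StephenMap.exists_square {f : C ⟶ D} {g : C ⟶ E} (hf : StephenMap R f)
    (hg : StephenMap R g) :
    ∃ (F : Automaton.{u, v} (Letter A)) (h : D ⟶ F) (k : E ⟶ F),
      StephenMap R h ∧ StephenMap R k ∧ f ≫ h = g ≫ k := by
  obtain ⟨F, h, k, hk, sq⟩ := hf.exists_isPushout g
  obtain ⟨F', k', h', hh', sq'⟩ := hg.exists_isPushout f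
  let e : F' ≅ F := sq'.flip.isoIsPushout _ _ sq
  refine ⟨F, h, k, ?_, hk, sq.w⟩
  rw [← show h' ≫ e.hom = h from sq'.flip.inl_isoIsPushout_hom _ _ sq]
  exact hh'.comp (StephenMap.of_isIso e.hom)

end StephenMap

/-! ### The closure as a Schützenberger automaton -/

section Closure

variable {A : Type u} {R : Set (Word A × Word A)} {B : Automaton.{u, v} (Letter A)}

theorem colimRel_iff {O P : StephenObj R B} {s : O.aut.State} {t : P.aut.State} :
    ColimRel R B ⟨O, s⟩ ⟨P, t⟩ ↔ ∃ h : Hom O.aut P.aut,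
      StephenMap R h ∧ O.map.comp h = P.map ∧ h.toFun s = t := by
  constructor
  · rintro ⟨_, _, h, hh, comm, _⟩
    exact ⟨h, hh, comm, rfl⟩
  · rintro ⟨h, hh, comm, rfl⟩
    exact ColimRel.step O P h hh comm s

/-- The object obtained from `O` by a further morphism of Stephen's system. -/
def StephenObj.extend (O : StephenObj R B) {D : Automaton.{u, v} (Letter A)} (f : Hom O.aut D)
    (hf : StephenMap R f) : StephenObj R B :=
  ⟨D, O.map.comp f, O.isMap.comp hf⟩

instance isPreorder_colimRel : IsPreorder _ (ColimRel R B) where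
  refl x := colimRel_iff.2
    ⟨_, StephenMap.of_isIso (CategoryTheory.CategoryStruct.id x.1.aut), rfl, rfl⟩
  trans x y z hxy hyz := by
    obtain ⟨f, hf, hxf, hfx⟩ := colimRel_iff.1 hxy
    obtain ⟨g, hg, hyg, hgy⟩ := colimRel_iff.1 hyz
    exact colimRel_iff.2 ⟨f.comp g, hf.comp hg, (congrArg (Hom.comp · g) hxf).trans hyg,
      (congrArg g.toFun hfx).trans hgy⟩

theorem equivalence_join_colimRel : Equivalence (Relation.Join (ColimRel R B)) := by
  refine Relation.equivalence_join fun x y z hxy hxz => ?_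
  obtain ⟨f, hf, hxf, hfx⟩ := colimRel_iff.1 hxy
  obtain ⟨g, hg, hxg, hgx⟩ := colimRel_iff.1 hxz
  obtain ⟨F, h, k, hh, hk, sq⟩ := hf.exists_square hg
  refine ⟨⟨y.1.extend h hh, h.toFun y.2⟩, colimRel_iff.2 ⟨h, hh, rfl, rfl⟩,
    colimRel_iff.2 ⟨k, hk, ?_, ?_⟩⟩
  · change z.1.map.comp k = y.1.map.comp h
    rw [← hxg, ← hxf]
    exact congrArg x.1.map.comp sq.symm
  · rw [← hgx, ← hfx]
    exact (Hom.congr_toFun sq x.2).symm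

/-- The canonical morphism from an object of the directed system to the closure. -/
def StephenObj.toClosure (O : StephenObj R B) : Hom O.aut (closure R B) where
  toFun s := Quot.mk _ ⟨O, s⟩
  map_init := by
    rw [← O.map.map_init]
    exact (Quot.sound (ColimRel.step (StephenObj.base R B) O O.map O.isMap rfl B.init)).symm
  map_term := by
    rw [← O.map.map_term]
    exact (Quot.sound (ColimRel.step (StephenObj.base R B) O O.map O.isMap rfl B.term)).symm
  map_edge p _ q h := ⟨O, p, q, rfl, rfl, h⟩

theorem StephenObj.toClosure_comp {O P : StephenObj R B} {f : Hom O.aut P.aut}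
    (hf : StephenMap R f) (comm : O.map.comp f = P.map) (s : O.aut.State) :
    P.toClosure.toFun (f.toFun s) = O.toClosure.toFun s :=
  (Quot.sound (ColimRel.step O P f hf comm s)).symm

theorem StephenObj.exists_of_toClosure_eq {O P : StephenObj R B} {s : O.aut.State}
    {t : P.aut.State} (h : O.toClosure.toFun s = P.toClosure.toFun t) :
    ∃ (Q : StephenObj R B) (f : Hom O.aut Q.aut) (g : Hom P.aut Q.aut),
      f.toFun s = g.toFun t ∧ (∀ r, Q.toClosure.toFun (f.toFun r) = O.toClosure.toFun r) ∧
        ∀ r, Q.toClosure.toFun (g.toFun r) = P.toClosure.toFun r := by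
  have hjoin : Relation.Join (ColimRel R B) ⟨O, s⟩ ⟨P, t⟩ :=
    equivalence_join_colimRel.eqvGen_iff.1
      (Relation.EqvGen.eqvGen_mono Relation.le_join_of_refl _ _ (Quot.eqvGen_exact h))
  obtain ⟨⟨Q, r⟩, hO, hP⟩ := hjoin
  obtain ⟨f, hf, hOf, hfs⟩ := colimRel_iff.1 hO
  obtain ⟨g, hg, hPg, hgt⟩ := colimRel_iff.1 hP
  exact ⟨Q, f, g, hfs.trans hgt.symm, toClosure_comp hf hOf, toClosure_comp hg hPg⟩

theorem exists_toClosure_eq (S : (closure R B).State) :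
    ∃ (O : StephenObj R B) (s : O.aut.State), O.toClosure.toFun s = S := by
  obtain ⟨⟨O, s⟩⟩ := S
  exact ⟨O, s, rfl⟩

theorem exists_edge_of_closure_edge {S T : (closure R B).State} {x : Letter A}
    (h : (closure R B).edge S x T) :
    ∃ (O : StephenObj R B) (s t : O.aut.State),
      O.toClosure.toFun s = S ∧ O.toClosure.toFun t = T ∧ O.aut.edge s x t := h

theorem exists_path_of_closure_path {S T : (closure R B).State} {w : List (Letter A)}
    (h : (closure R B).Path S w T) :
    ∃ (O : StephenObj R B) (s t : O.aut.State),
      O.toClosure.toFun s = S ∧ O.toClosure.toFun t = T ∧ O.aut.Path s w t := by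
  induction w generalizing S with
  | nil =>
    obtain ⟨O, s, hs⟩ := exists_toClosure_eq S
    exact ⟨O, s, s, hs, hs.trans h, rfl⟩
  | cons x w ih =>
    obtain ⟨U, hSU, hUT⟩ := h
    obtain ⟨O, s, r, rfl, hr, hsr⟩ := exists_edge_of_closure_edge hSU
    obtain ⟨P, r', t, hr', rfl, hrt⟩ := ih hUT
    obtain ⟨Q, f, g, hfg, hf, hg⟩ := StephenObj.exists_of_toClosure_eq (hr.trans hr'.symm)
    exact ⟨Q, f.toFun s, g.toFun t, hf s, hg t, f.toFun r, f.map_edge _ _ _ hsr,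
      hfg ▸ g.map_path hrt⟩

theorem deterministic_closure : (closure R B).Deterministic := by
  intro S x T T' h h'
  obtain ⟨O, s, t, rfl, rfl, hst⟩ := exists_edge_of_closure_edge h
  obtain ⟨P, s', t', hs, rfl, hst'⟩ := exists_edge_of_closure_edge h'
  obtain ⟨Q, f, g, hfg, hf, hg⟩ := StephenObj.exists_of_toClosure_eq hs.symm
  have hfold : StephenMap R (Q.aut.toQuot (Q.aut.Single (f.toFun t) (g.toFun t'))) :=
    StephenMap.folding Q.aut _ _ _ x (f.map_edge _ _ _ hst) (hfg ▸ g.map_edge _ _ _ hst')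
  rw [← hf, ← hg, ← StephenObj.toClosure_comp (P := Q.extend _ hfold) hfold rfl,
    ← StephenObj.toClosure_comp (P := Q.extend _ hfold) hfold rfl]
  exact congrArg _ (Quot.sound ⟨rfl, rfl⟩)

theorem involutive_closure (hB : B.Involutive) : (closure R B).Involutive := by
  intro S x T h
  obtain ⟨O, s, t, rfl, rfl, e⟩ := exists_edge_of_closure_edge h
  exact O.toClosure.map_edge _ _ _ (O.isMap.involutive hB e)

theorem stephenClosed_closure (hB : B.Involutive) : (closure R B).StephenClosed R where
  deterministic := deterministic_closure
  involutive := involutive_closure hB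
  path_of_mem := by
    intro S T u v huv h
    obtain ⟨O, s, t, rfl, rfl, p⟩ := exists_path_of_closure_path h
    have hexp := StephenMap.expansion O.aut s t u v huv p
    rw [← StephenObj.toClosure_comp (P := O.extend _ hexp) hexp rfl,
      ← StephenObj.toClosure_comp (P := O.extend _ hexp) hexp rfl]
    exact (O.extend _ hexp).toClosure.map_path path_toAddPath

theorem accessible_closure (hB : B.Accessible) : (closure R B).Accessible := by
  intro S
  obtain ⟨O, s, rfl⟩ := exists_toClosure_eq S
  obtain ⟨w, hw⟩ := O.isMap.accessible hB s
  exact ⟨w, O.toClosure.map_init ▸ O.toClosure.map_path hw⟩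

theorem nonempty_hom_closure (hB : B.Accessible) {Z : Automaton.{u, v} (Letter A)}
    (hZ : Z.StephenClosed R) (g : Hom B Z) : Nonempty (Hom (closure R B) Z) := by
  choose φ _ using fun O : StephenObj R B => O.isMap.exists_extension hZ g
  have φ_comp (O P : StephenObj R B) (h : Hom O.aut P.aut) : φ O = h.comp (φ P) :=
    (O.isMap.accessible hB).hom_unique hZ.deterministic _ _
  refine ⟨⟨Quot.lift (fun x => (φ x.1).toFun x.2) ?_, (φ _).map_init, (φ _).map_term, ?_⟩⟩
  · rintro _ _ ⟨O, P, h, _, _, s⟩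
    exact Hom.congr_toFun (φ_comp O P h) s
  · rintro _ x _ ⟨O, s, t, rfl, rfl, e⟩
    exact (φ O).map_edge _ _ _ e

theorem nonempty_iso_closure {B : Automaton.{u, u} (Letter A)} {w : Word A} (hi : B.Involutive)
    (ha : B.Accessible) (hw : B.Path B.init w.toList B.term) (g : Hom B (schutzenberger R w)) :
    Nonempty (Iso (schutzenberger R w) (closure R B)) := by
  obtain ⟨φ⟩ := nonempty_hom_closure ha stephenClosed_schutzenberger g
  have hw' : (closure R B).Path (closure R B).init w.toList (closure R B).term :=
    (StephenObj.base R B).toClosure.map_path hw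
  obtain ⟨e⟩ := nonempty_iso_schutzenberger (stephenClosed_closure hi) (accessible_closure ha) hw' φ
  exact ⟨e.symm⟩

end Closure

end Automaton

/-! ### Contracted Schützenberger automata -/

section Contraction

variable {A : Type u} {a : A}

theorem erase_of_eq {x : Letter A} (h : x.1 = a) : erase a (FreeMonoid.of x) = 1 := by
  simp [erase, h]

theorem erase_of_ne {x : Letter A} (h : x.1 ≠ a) :
    erase a (FreeMonoid.of x) = FreeMonoid.of (⟨x.1, h⟩, x.2) := by
  simp [erase, h]

theorem erase_inv (w : Word A) : erase a w.inv = (erase a w).inv := by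
  induction w using FreeMonoid.inductionOn' with
  | one => simp [Word.inv]
  | of_mul x w ih =>
    have erase_inv_of : erase a (FreeMonoid.of x.inv) = (erase a (FreeMonoid.of x)).inv := by
      by_cases h : x.1 = a
      · rw [erase_of_eq h, erase_of_eq (x := x.inv) h]
        rfl
      · rw [erase_of_ne h, erase_of_ne (x := x.inv) h]
        rfl
    rw [Word.inv_mul, map_mul, map_mul, Word.inv_mul, ih, Word.inv_of, erase_inv_of]

theorem VagnerRel.erase {u v : Word A} (h : VagnerRel A u v) :
    VagnerRel {b : A // b ≠ a} (erase a u) (erase a v) := by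
  cases h <;> simp only [map_mul, erase_inv]
  · exact VagnerRel.regular _
  · exact VagnerRel.commute _ _

/-- The homomorphism `Inv⟨A | R⟩ → Inv⟨A_a | Rθ̄_a⟩` induced by erasing `a`. -/
noncomputable def eraseHom (a : A) (R : Set (Word A × Word A)) :
    PresMonoid R →* PresMonoid (eraseRel a R) :=
  (presCon R).lift ((presCon (eraseRel a R)).mk'.comp (erase a)) <|
    presCon_le (fun _ _ h => cls_eq_of_vagnerRel h.erase)
      fun u v h => cls_eq_of_mem (R := eraseRel a R) ⟨(u, v), h, rfl⟩

theorem eraseHom_cls (R : Set (Word A × Word A)) (u : Word A) :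
    eraseHom a R (cls R u) = cls (eraseRel a R) (erase a u) := rfl

namespace Automaton

variable {B : Automaton.{u, v} (Letter A)}

theorem Involutive.contract (hB : B.Involutive) : (B.contract a).Involutive := by
  have collapse : (B.collapse a).Involutive := by
    rintro _ x _ ⟨p, q, rfl, rfl, e⟩
    exact ⟨q, p, rfl, rfl, hB e⟩
  exact collapse.quot _

/-- The projection of the states of `B` to those of the `a`-contracted automaton. -/
def contractMk (a : A) (B : Automaton.{u, v} (Letter A)) (p : B.State) : (B.contract a).State :=
  ((B.collapse a).toQuot _).toFun (Quot.mk _ p)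

theorem contractMk_surjective : Function.Surjective (contractMk a B) :=
  Quot.mk_surjective.comp Quot.mk_surjective

theorem Involutive.contractMk_eq (hB : B.Involutive) {p q : B.State} {x : Letter A}
    (hx : x.1 = a) (h : B.edge p x q) : contractMk a B p = contractMk a B q := by
  obtain ⟨a, b⟩ := x
  subst hx
  refine congrArg ((B.collapse a).toQuot _).toFun ?_
  cases b with
  | true => exact Quot.sound h
  | false => exact (Quot.sound (hB h)).symm

theorem edge_contractMk {p q : B.State} {x : Letter A} (hx : x.1 ≠ a) (h : B.edge p x q) :
    (B.contract a).edge (contractMk a B p) (⟨x.1, hx⟩, x.2) (contractMk a B q) :=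
  ((B.collapse a).toQuot _).map_edge _ _ _ ⟨p, q, rfl, rfl, h⟩

theorem Involutive.path_contractMk (hB : B.Involutive) {p q : B.State} {w : Word A}
    (h : B.Path p w.toList q) :
    (B.contract a).Path (contractMk a B p) (erase a w).toList (contractMk a B q) := by
  induction w using FreeMonoid.inductionOn' generalizing p with
  | one => exact congrArg _ h
  | of_mul x w ih =>
    obtain ⟨r, hpr, hrq⟩ := h
    rw [map_mul]
    by_cases hx : x.1 = a
    · rw [erase_of_eq hx, one_mul, hB.contractMk_eq hx hpr]
      exact ih hrq
    · rw [erase_of_ne hx]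
      exact ⟨_, edge_contractMk hx hpr, ih hrq⟩

theorem Accessible.contract (hB : B.Accessible) (hi : B.Involutive) :
    (B.contract a).Accessible := by
  intro S
  obtain ⟨q, rfl⟩ := contractMk_surjective S
  obtain ⟨w, hw⟩ : ∃ w : Word A, B.Path B.init w.toList q := hB q
  exact ⟨_, hi.path_contractMk hw⟩

/-- The morphism from the `a`-contracted automaton to a deterministic automaton induced by a map on
states that identifies the ends of transitions labelled `a` and preserves the other transitions. -/
def contractDesc {Z : Automaton.{u, v'} (Letter {b : A // b ≠ a})} (hZ : Z.Deterministic)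
    (f : B.State → Z.State) (hinit : f B.init = Z.init) (hterm : f B.term = Z.term)
    (heq : ∀ p q, B.edge p (a, true) q → f p = f q)
    (hedge : ∀ p (x : Letter {b : A // b ≠ a}) q,
      B.edge p (x.1.val, x.2) q → Z.edge (f p) x (f q)) :
    Hom (B.contract a) Z :=
  let g : Hom (B.collapse a) Z :=
    { toFun := Quot.lift f heq
      map_init := hinit
      map_term := hterm
      map_edge := by
        rintro _ x _ ⟨p, q, rfl, rfl, e⟩
        exact hedge p x q e }
  quotDesc _ g fun _ _ => hZ.map_eq_of_foldRel g

end Automaton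

open Automaton

/-- The morphism `χ_a(𝒜(w)) → 𝒜(wθ_a)` induced by erasing `a`. -/
noncomputable def contractSchutzenbergerHom (a : A) (R : Set (Word A × Word A)) (w : Word A) :
    Hom (contract a (schutzenberger R w)) (schutzenberger (eraseRel a R) (erase a w)) :=
  contractDesc stephenClosed_schutzenberger.deterministic
    (fun m => ⟨eraseHom a R m.val, m.2.map _⟩)
    (Subtype.ext (by
      change cls _ (erase a _) = cls _ _
      rw [map_mul, erase_inv]))
    rfl
    (by
      rintro p ⟨_, hq⟩ rfl
      refine Subtype.ext ?_
      change eraseHom a R p.val = eraseHom a R (p.val * _)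
      rw [map_mul, eraseHom_cls, erase_of_eq (x := (a, true)) rfl]
      exact (mul_one _).symm)
    (by
      rintro p x ⟨_, hq⟩ rfl
      change eraseHom a R (p.val * _) = _
      rw [map_mul, eraseHom_cls, erase_of_ne x.1.2])

end Contraction

end InvPres

theorem proposition4p12 {A : Type u} (R : Set (InvPres.Word A × InvPres.Word A)) (a : A)
    (w : InvPres.Word A) :
    Nonempty (InvPres.Automaton.Iso
      (InvPres.schutzenberger (InvPres.eraseRel a R) (InvPres.erase a w))
      (InvPres.Automaton.closure (InvPres.eraseRel a R)
        (InvPres.Automaton.contract a (InvPres.schutzenberger R w)))) := by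
  open InvPres Automaton in
  have hi : (schutzenberger R w).Involutive := stephenClosed_schutzenberger.involutive
  have accepts : (contract a (schutzenberger R w)).Path (contract a (schutzenberger R w)).init
      (erase a w).toList (contract a (schutzenberger R w)).term :=
    hi.path_contractMk (path_schutzenberger_of_cls_eq (m := (schutzenberger R w).term) rfl)
  exact nonempty_iso_closure hi.contract (accessible_schutzenberger.contract hi) accepts
    (contractSchutzenbergerHom a R w)
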